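/- Let $p$ be a prime and let $a,d$ be positive integers with $a\mid d$ and $d\ge 2a$. Let $t\in\{4,5\}$. Then there is no non-trivial Steiner $t$-design $\mathcal D=(X,\mathcal B)$ admitting a block-transitive group $G\le \mathrm{Aut}(\mathcal D)$ of automorphisms that is of affine type with $G_0\trianglerighteq Sp(\tfrac{2d}{a},p^a)$. Here a Steiner $t$-design is a finite set $X$ of $v$ points with a set $\mathcal B$ of $k$-subsets of $X$ (blocks), $t\le k\le v$, such that every $t$-subset of $X$ is contained in exactly one block; it is non-trivial if $t<k<v$. Automorphisms are the permutations of $X$ preserving $\mathcal B$, and $G$ is block-transitive if it is transitive on $\mathcal B$. A $2$-transitive permutation group $G$ on $X$ is of affine type if it contains a regular normal elementary Abelian subgroup $T$ of prime power order. The condition $G_0\trianglerighteq Sp(\tfrac{2d}{a},p^a)$ means that $|X|=p^{2d}$ and that $X$ can be identified with a vector space $V$ of dimension $\tfrac{2d}{a}$ over $GF(p^a)$, equipped with a non-degenerate alternating bilinear form, in such a way that $T$ is the group of all translations of $V$ and the stabilizer $G_0$ of the zero vector in $G$ contains the full symplectic group $Sp(V)\cong Sp(\tfrac{2d}{a},p^a)$,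 in its natural action on $V$, as a normal subgroup. -/

import Mathlib

/-- `IsDesign 𝓑 t v k l`: the point set `X` together with the set of blocks `𝓑` is a (simple)
`t`-`(v, k, l)` design. As `v` is positive, `Nat.card X = v` makes `X` finite. -/
structure IsDesign {X : Type*} (𝓑 : Set (Finset X)) (t v k l : ℕ) : Prop where
  t_pos : 0 < t
  t_le_k : t ≤ k
  k_le_v : k ≤ v
  l_pos : 0 < l
  card_points : Nat.card X = v
  card_block : ∀ B ∈ 𝓑, B.card = k
  card_blocks_through : ∀ S : Finset X, S.card = t → {B ∈ 𝓑 | S ⊆ B}.ncard = l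

/-- A Steiner `t`-design is a `t`-`(v, k, 1)` design; it is non-trivial if `t < k < v`. -/
def IsNontrivialSteinerDesign {X : Type*} (𝓑 : Set (Finset X)) (t v k : ℕ) : Prop :=
  IsDesign 𝓑 t v k 1 ∧ t < k ∧ k < v

/-- The automorphism group of a design: all permutations of the points that preserve the set
of blocks. -/
def designAut {X : Type*} (𝓑 : Set (Finset X)) : Subgroup (Equiv.Perm X) where
  carrier := {g | ∀ B : Finset X, B.map g.toEmbedding ∈ 𝓑 ↔ B ∈ 𝓑}
  one_mem' := by
    intro B
    have e : (1 : Equiv.Perm X).toEmbedding = Function.Embedding.refl X := rfl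
    rw [e, Finset.map_refl]
  mul_mem' := by
    intro g h hg hh B
    have e : B.map (g * h).toEmbedding = (B.map h.toEmbedding).map g.toEmbedding := by
      rw [Finset.map_map]; rfl
    rw [e, hg, hh]
  inv_mem' := by
    intro g hg B
    rw [← hg (B.map (g⁻¹).toEmbedding), Finset.map_map]
    have e : (g⁻¹).toEmbedding.trans g.toEmbedding = Function.Embedding.refl X := by
      ext x; simp
    rw [e, Finset.map_refl]

/-- A group of permutations of the points acts transitively on the blocks. -/
def IsBlockTransitive {X : Type*} (G : Subgroup (Equiv.Perm X)) (𝓑 : Set (Finset X)) : Prop :=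
  ∀ B ∈ 𝓑, ∀ C ∈ 𝓑, ∃ g ∈ G, B.map g.toEmbedding = C

/-- The permutation group `G` is of affine type with translation group `T`: it is
`2`-transitive, and `T` is a regular normal subgroup of `G` which is elementary abelian of
order `p ^ m`. -/
structure IsAffineType {X : Type*} (p m : ℕ) (G T : Subgroup (Equiv.Perm X)) : Prop where
  two_transitive : MulAction.IsMultiplyPretransitive G X 2
  le : T ≤ G
  normal : (T.subgroupOf G).Normal
  regular : ∀ x y : X, ∃! g : Equiv.Perm X, g ∈ T ∧ g x = y
  comm : ∀ g ∈ T, ∀ h ∈ T, g * h = h * g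
  exponent : ∀ g ∈ T, g ^ p = 1
  card : Nat.card T = p ^ m

/-- The coordinate space of dimension `2 * n` over the field with `p ^ a` elements. -/
abbrev SpSpace (p a n : ℕ) [Fact p.Prime] : Type := Fin n ⊕ Fin n → GaloisField p a

/-- The symplectic group `Sp(2n, p ^ a)` in its natural action, carried over to `X` by an
identification `e` of `X` with the coordinate space of dimension `2 * n`. -/
def spPerm {X : Type*} {p a n : ℕ} [Fact p.Prime] (e : X ≃ SpSpace p a n) :
    Subgroup (Equiv.Perm X) where
  carrier := {g | ∃ A ∈ Matrix.symplecticGroup (Fin n) (GaloisField p a),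
    ∀ x, e (g x) = A.mulVec (e x)}
  one_mem' := ⟨1, one_mem _, fun x => by simp⟩
  mul_mem' := by
    rintro g h ⟨A, hA, hg⟩ ⟨B, hB, hh⟩
    exact ⟨A * B, mul_mem hA hB, fun x => by
      rw [Equiv.Perm.mul_apply, hg, hh, Matrix.mulVec_mulVec]⟩
  inv_mem' := by
    rintro g ⟨A, hA, hg⟩
    refine ⟨((⟨A, hA⟩ : Matrix.symplecticGroup (Fin n) (GaloisField p a))⁻¹).1,
      Subtype.property _, fun x => ?_⟩
    have h := hg (g⁻¹ x)
    have hx : g (g⁻¹ x) = x := g.apply_symm_apply x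
    have hu : (((⟨A, hA⟩ : Matrix.symplecticGroup (Fin n) (GaloisField p a))⁻¹).1) * A = 1 :=
      congrArg Subtype.val
        (inv_mul_cancel (⟨A, hA⟩ : Matrix.symplecticGroup (Fin n) (GaloisField p a)))
    rw [hx] at h
    rw [h, Matrix.mulVec_mulVec, hu, Matrix.one_mulVec]

/-- The stabilizer `G_x` of a point. -/
def pointStabilizer {X : Type*} (G : Subgroup (Equiv.Perm X)) (x : X) :
    Subgroup (Equiv.Perm X) :=
  G ⊓ MulAction.stabilizer (Equiv.Perm X) x

/-- The permutation group `G` on `X` is of affine type and, for a suitable identification `e`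
of `X` with the `2n`-dimensional vector space over the field with `p ^ a` elements under which
the regular normal subgroup `T` becomes the group of all translations, the stabilizer `G_0` of
the zero vector contains `Sp(2n, p ^ a)` as a normal subgroup. Here `n = d / a` (used for
`a ∣ d`), so that `2n = 2d / a` and `X` has `p ^ (2d)` points. -/
def IsAffineTypeSp {X : Type*} (p d a : ℕ) [Fact p.Prime] (G : Subgroup (Equiv.Perm X)) :
    Prop :=
  ∃ (T : Subgroup (Equiv.Perm X)) (e : X ≃ SpSpace p a (d / a)),
    IsAffineType p (2 * d) G T ∧
    (∀ g : Equiv.Perm X, g ∈ T ↔ ∃ u, ∀ x, e (g x) = e x + u) ∧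
    spPerm e ≤ pointStabilizer G (e.symm 0) ∧
    ((spPerm e).subgroupOf (pointStabilizer G (e.symm 0))).Normal

/-!
Let `V` be the symplectic space of dimension `2n ≥ 4` over the field with `q` elements, and let
`W` be a Lagrangian subspace, so that `W` is its own orthogonal complement and `|W| ^ 2 = |V|`.

Suppose `|W| ≥ t`. A block `B` with `t` points in `W` is invariant under every symplectic
transvection with centre in `W`, since such a transvection fixes `W` pointwise. If `B` contains a
point `x` outside `W`, these transvections carry `x` to all of `x + W`, so that
`k ≥ t + |W|`. This contradicts the bound `(k - t + 2) (k - t + 1) ≤ v - t + 1` valid in every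
non-trivial Steiner `t`-design with `t ≥ 2` (`IsNontrivialSteinerDesign.card_bound`). Hence `B ⊆ W`
(`block_subset_lagrangian`).

The group `G` acts by maps `x ↦ g x + c` with `g` additive, because the translation group is
normal in `G`. Moreover `g` preserves orthogonality, because the symplectic group is normal in
`G_0` (`sympForm_map_eq_zero`). By block-transitivity, in every block through `0` any two points
are then orthogonal. But some block contains `0` and two points that are not orthogonal, a
contradiction (`card_lagrangian_lt`).

As `t ≤ 5` and `|W| = q ^ n ≥ 4`, only `q = 2`, `n = 2`, `t = 5` is left. There the block through
the plane `W` and one further point is shown to lie in a hyperplane; block-transitivity then puts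
every block into an affine hyperplane, although five points can be in general position
(`not_steiner_five_sixteen`).
-/

/-! ### Steiner designs -/

section Steiner

variable {X : Type*} {𝓑 : Set (Finset X)} {t v k : ℕ}

theorem IsDesign.exists_block (h : IsDesign 𝓑 t v k 1) {S : Finset X} (hS : S.card = t) :
    ∃ B ∈ 𝓑, S ⊆ B := by
  obtain ⟨B, hB⟩ := Set.ncard_eq_one.1 (h.card_blocks_through S hS)
  have : B ∈ {B ∈ 𝓑 | S ⊆ B} := hB ▸ Set.mem_singleton B
  exact ⟨B, this.1, this.2⟩

theorem IsDesign.block_unique (h : IsDesign 𝓑 t v k 1) {S B C : Finset X} (hS : t ≤ S.card)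
    (hB : B ∈ 𝓑) (hC : C ∈ 𝓑) (hSB : S ⊆ B) (hSC : S ⊆ C) : B = C := by
  obtain ⟨R, hRS, hR⟩ := Finset.exists_subset_card_eq hS
  obtain ⟨D, hD⟩ := Set.ncard_eq_one.1 (h.card_blocks_through R hR)
  have h1 : B ∈ {B ∈ 𝓑 | R ⊆ B} := ⟨hB, hRS.trans hSB⟩
  have h2 : C ∈ {B ∈ 𝓑 | R ⊆ B} := ⟨hC, hRS.trans hSC⟩
  rw [hD] at h1 h2
  exact h1.trans h2.symm

/-- An automorphism fixing at least `t` points of a block maps that block to itself. -/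
theorem IsDesign.apply_mem_block (h : IsDesign 𝓑 t v k 1) {g : Equiv.Perm X}
    (hg : g ∈ designAut 𝓑) {S B : Finset X} (hS : t ≤ S.card) (hB : B ∈ 𝓑) (hSB : S ⊆ B)
    (hfix : ∀ x ∈ S, g x = x) {x : X} (hx : x ∈ B) : g x ∈ B := by
  have hB' : B.map g.toEmbedding ∈ 𝓑 := (hg B).2 hB
  have hSB' : S ⊆ B.map g.toEmbedding := fun y hy =>
    Finset.mem_map.2 ⟨y, hSB hy, hfix y hy⟩
  have e := h.block_unique hS hB' hB hSB' hSB
  rw [← e]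
  exact Finset.mem_map.2 ⟨x, hx, rfl⟩

/-- In a non-trivial Steiner `t`-design with `t ≥ 2`, fix a block `B`, a point `q` outside it
and `t - 2` points of `B`. The blocks through these points, `q` and one further point of `B`
are pairwise disjoint apart from the `t - 1` fixed points, whence
`(k - t + 2) (k - t + 1) ≤ v - t + 1`. -/
theorem IsNontrivialSteinerDesign.card_bound (h : IsNontrivialSteinerDesign 𝓑 t v k)
    (ht : 2 ≤ t) : (k + 2 - t) * (k + 1 - t) + t ≤ v + 1 := by
  classical
  obtain ⟨hD, htk, hkv⟩ := h
  have : Finite X := Nat.finite_of_card_ne_zero (by rw [hD.card_points]; omega)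
  have := Fintype.ofFinite X
  have hv : Fintype.card X = v := by rw [← Nat.card_eq_fintype_card, hD.card_points]
  obtain ⟨S₀, -, hS₀⟩ := Finset.exists_subset_card_eq
    (show t ≤ (Finset.univ : Finset X).card by rw [Finset.card_univ]; omega)
  obtain ⟨B, hB, -⟩ := hD.exists_block hS₀
  have hBk := hD.card_block B hB
  obtain ⟨q, hq⟩ : ∃ q, q ∉ B := by
    by_contra! hall
    have : B = Finset.univ := Finset.eq_univ_of_forall hall
    rw [this, Finset.card_univ] at hBk
    omega
  obtain ⟨S, hSB, hS⟩ := Finset.exists_subset_card_eq (show t - 2 ≤ B.card by omega)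
  have hqS : q ∉ S := fun hh => hq (hSB hh)
  have hR : ∀ y ∈ B \ S, (insert y (insert q S)).card = t := by
    intro y hy
    rw [Finset.mem_sdiff] at hy
    rw [Finset.card_insert_of_notMem, Finset.card_insert_of_notMem hqS, hS]
    · omega
    · rw [Finset.mem_insert, not_or]
      exact ⟨fun e => hq (e ▸ hy.1), hy.2⟩
  choose! C hC hRC using fun y hy => hD.exists_block (hR y hy)
  have hsub : ∀ y ∈ B \ S, insert q S ⊆ C y := fun y hy =>
    (Finset.subset_insert _ _).trans (hRC y hy)
  have hcard : ∀ y ∈ B \ S, (C y \ insert q S).card = k + 1 - t := by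
    intro y hy
    rw [Finset.card_sdiff_of_subset (hsub y hy), hD.card_block _ (hC y hy),
      Finset.card_insert_of_notMem hqS, hS]
    omega
  have hdisj : ∀ y ∈ B \ S, ∀ z ∈ B \ S, y ≠ z →
      Disjoint (C y \ insert q S) (C z \ insert q S) := by
    intro y hy z hz hyz
    rw [Finset.disjoint_left]
    intro x hx hx'
    rw [Finset.mem_sdiff] at hx hx'
    have hins : ∀ w ∈ B \ S, x ∈ C w → insert x (insert q S) ⊆ C w := fun w hw hxw =>
      Finset.insert_subset hxw (hsub w hw)
    have e : C y = C z := by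
      refine hD.block_unique (S := insert x (insert q S)) ?_ (hC y hy) (hC z hz)
        (hins y hy hx.1) (hins z hz hx'.1)
      rw [Finset.card_insert_of_notMem hx.2, Finset.card_insert_of_notMem hqS, hS]
      omega
    -- The common block would contain `t` points of `B`, but also `q`.
    have hyC : y ∈ C y := hRC y hy (Finset.mem_insert_self _ _)
    have hzC : z ∈ C y := e ▸ hRC z hz (Finset.mem_insert_self _ _)
    have hqC : q ∈ C y := hsub y hy (Finset.mem_insert_self _ _)
    rw [Finset.mem_sdiff] at hy hz
    have e' : C y = B := by
      refine hD.block_unique (S := insert y (insert z S)) ?_ (hC y (Finset.mem_sdiff.2 hy)) hB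
        ?_ ?_
      · rw [Finset.card_insert_of_notMem, Finset.card_insert_of_notMem hz.2, hS]
        · omega
        · rw [Finset.mem_insert, not_or]
          exact ⟨hyz, hy.2⟩
      · exact Finset.insert_subset hyC (Finset.insert_subset hzC
          ((Finset.subset_insert _ _).trans (hsub y (Finset.mem_sdiff.2 hy))))
      · exact Finset.insert_subset hy.1 (Finset.insert_subset hz.1 hSB)
    exact hq (e' ▸ hqC)
  have hU : ((B \ S).biUnion fun y => C y \ insert q S).card = (k + 2 - t) * (k + 1 - t) := by
    rw [Finset.card_biUnion hdisj, Finset.sum_congr rfl hcard, Finset.sum_const, smul_eq_mul,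
      Finset.card_sdiff_of_subset hSB, hBk, hS]
    congr 1
    omega
  have hle : ((B \ S).biUnion fun y => C y \ insert q S).card ≤
      (Finset.univ \ insert q S).card := by
    refine Finset.card_le_card fun x hx => ?_
    obtain ⟨y, -, hy⟩ := Finset.mem_biUnion.1 hx
    exact Finset.mem_sdiff.2 ⟨Finset.mem_univ _, (Finset.mem_sdiff.1 hy).2⟩
  rw [hU, Finset.card_sdiff_of_subset (Finset.subset_univ _), Finset.card_univ, hv,
    Finset.card_insert_of_notMem hqS, hS] at hle
  omega

/-- Transport of a non-trivial Steiner design along a bijection of the point sets. -/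
theorem IsNontrivialSteinerDesign.transport {Y : Type*} (e : X ≃ Y)
    (h : IsNontrivialSteinerDesign 𝓑 t v k) :
    IsNontrivialSteinerDesign {B : Finset Y | B.map e.symm.toEmbedding ∈ 𝓑} t v k := by
  obtain ⟨hD, htk, hkv⟩ := h
  refine ⟨⟨hD.t_pos, hD.t_le_k, hD.k_le_v, hD.l_pos, ?_, ?_, ?_⟩, htk, hkv⟩
  · rw [← Nat.card_congr e, hD.card_points]
  · intro B hB
    rw [← hD.card_block _ hB, Finset.card_map]
  · intro S hS
    rw [← hD.card_blocks_through (S.map e.symm.toEmbedding) (by rw [Finset.card_map, hS])]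
    refine Set.ncard_congr (fun B _ => B.map e.symm.toEmbedding) ?_ ?_ ?_
    · rintro B ⟨hB, hSB⟩
      exact ⟨hB, Finset.map_subset_map.2 hSB⟩
    · intro B C _ _ hBC
      exact Finset.map_injective _ hBC
    · rintro B ⟨hB, hSB⟩
      have e' : (B.map e.toEmbedding).map e.symm.toEmbedding = B := by
        rw [Finset.map_map]
        ext x
        simp
      refine ⟨B.map e.toEmbedding, ⟨?_, ?_⟩, e'⟩
      · rw [Set.mem_ofPred_eq, e']
        exact hB
      · rw [← Finset.map_subset_map (f := e.symm.toEmbedding), e']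
        exact hSB

end Steiner

/-! ### The symplectic form and transvections -/

section Symplectic

open Matrix

variable {l F : Type*} [Fintype l] [DecidableEq l] [Field F]

/-- The standard alternating form on `F ^ (2n)`, with Gram matrix `Matrix.J`. -/
def sympForm (x y : l ⊕ l → F) : F := x ⬝ᵥ (J l F *ᵥ y)

theorem sympForm_apply (x y : l ⊕ l → F) :
    sympForm x y = ∑ i, (x (.inr i) * y (.inl i) - x (.inl i) * y (.inr i)) := by
  simp [sympForm, J, fromBlocks_mulVec, dotProduct, neg_mulVec, sub_eq_neg_add,
    Finset.sum_add_distrib]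

theorem sympForm_add_left (x y z : l ⊕ l → F) :
    sympForm (x + y) z = sympForm x z + sympForm y z := by
  simp [sympForm, add_dotProduct]

theorem sympForm_add_right (x y z : l ⊕ l → F) :
    sympForm x (y + z) = sympForm x y + sympForm x z := by
  simp [sympForm, mulVec_add]

theorem sympForm_smul_left (c : F) (x y : l ⊕ l → F) :
    sympForm (c • x) y = c * sympForm x y := by
  simp [sympForm]

theorem sympForm_smul_right (c : F) (x y : l ⊕ l → F) :
    sympForm x (c • y) = c * sympForm x y := by
  simp [sympForm, mulVec_smul]

theorem sympForm_swap (x y : l ⊕ l → F) : sympForm x y = -sympForm y x := by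
  rw [sympForm_apply, sympForm_apply, ← Finset.sum_neg_distrib]
  exact Finset.sum_congr rfl fun i _ => by ring

theorem sympForm_self (x : l ⊕ l → F) : sympForm x x = 0 := by
  rw [sympForm_apply]
  exact Finset.sum_eq_zero fun i _ => by ring

theorem sympForm_single_inl (x : l ⊕ l → F) (i : l) :
    sympForm x (Pi.single (.inl i) 1) = x (.inr i) := by
  simp [sympForm_apply, Pi.single_apply]

theorem sympForm_single_inr (x : l ⊕ l → F) (i : l) :
    sympForm x (Pi.single (.inr i) 1) = -x (.inl i) := by
  simp [sympForm_apply, Pi.single_apply]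

theorem exists_sympForm_ne_zero {x : l ⊕ l → F} (hx : x ≠ 0) : ∃ y, sympForm x y ≠ 0 := by
  by_contra! h
  refine hx (funext ?_)
  rintro (i | i)
  · simpa [sympForm_single_inr] using h (Pi.single (.inr i) 1)
  · simpa [sympForm_single_inl] using h (Pi.single (.inl i) 1)

theorem mem_symplecticGroup_iff_sympForm {A : Matrix (l ⊕ l) (l ⊕ l) F} :
    A ∈ symplecticGroup l F ↔ ∀ x y, sympForm (A *ᵥ x) (A *ᵥ y) = sympForm x y := by
  have key : ∀ x y, sympForm (A *ᵥ x) (A *ᵥ y) = x ⬝ᵥ ((Aᵀ * J l F * A) *ᵥ y) := by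
    intro x y
    rw [sympForm, ← mulVec_mulVec, ← mulVec_mulVec, dotProduct_mulVec x, vecMul_transpose]
  rw [SymplecticGroup.mem_iff']
  constructor
  · intro h x y
    rw [key, h, sympForm]
  · intro h
    ext i j
    have := h (Pi.single i 1) (Pi.single j 1)
    rw [key, sympForm] at this
    simpa using this

/-- The symplectic transvection `x ↦ x + c ω(x, u) u` with centre `u`. -/
def sympTransvection (u : l ⊕ l → F) (c : F) : Equiv.Perm (l ⊕ l → F) where
  toFun x := x + (c * sympForm x u) • u
  invFun x := x - (c * sympForm x u) • u
  left_inv x := by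
    simp [sympForm_add_left, sympForm_smul_left, sympForm_self]
  right_inv x := by
    simp [sub_eq_add_neg, ← neg_smul, sympForm_add_left, sympForm_smul_left, sympForm_self,
      add_assoc, ← add_smul]

theorem sympTransvection_apply (u : l ⊕ l → F) (c : F) (x : l ⊕ l → F) :
    sympTransvection u c x = x + (c * sympForm x u) • u := rfl

theorem sympTransvection_apply_of_orthogonal {u x : l ⊕ l → F} (c : F)
    (h : sympForm x u = 0) : sympTransvection u c x = x := by
  simp [sympTransvection_apply, h]

theorem exists_matrix_sympTransvection (u : l ⊕ l → F) (c : F) :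
    ∃ A ∈ symplecticGroup l F, ∀ x, sympTransvection u c x = A *ᵥ x := by
  have hA : ∀ x, sympTransvection u c x = (1 + c • vecMulVec u (J l F *ᵥ u)) *ᵥ x := by
    intro x
    rw [sympTransvection_apply, add_mulVec, one_mulVec, smul_mulVec, vecMulVec_mulVec,
      mul_smul, dotProduct_comm, sympForm]
    simp
  refine ⟨_, mem_symplecticGroup_iff_sympForm.2 fun x y => ?_, hA⟩
  rw [← hA, ← hA, sympTransvection_apply, sympTransvection_apply]
  simp only [sympForm_add_left, sympForm_add_right, sympForm_smul_left, sympForm_smul_right,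
    sympForm_self]
  rw [sympForm_swap u y]
  ring

/-- An additive bijection that normalizes the symplectic group preserves orthogonality: the
conjugate `σ` of the transvection with centre `g x` satisfies `(σ - 1) V = F x`, so it is a
transvection with centre `x` and fixes every `y` orthogonal to `x`. -/
theorem sympForm_map_eq_zero [Finite F] (g : (l ⊕ l → F) ≃+ (l ⊕ l → F))
    (hg : ∀ u, ∃ A ∈ symplecticGroup l F, ∀ x, g.symm (sympTransvection u 1 (g x)) = A *ᵥ x)
    {x y : l ⊕ l → F} (hxy : sympForm x y = 0) : sympForm (g x) (g y) = 0 := by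
  rcases eq_or_ne x 0 with rfl | hx
  · rw [map_zero, ← zero_smul F (0 : l ⊕ l → F), sympForm_smul_left, zero_mul]
  have hgx : g x ≠ 0 := by simpa using hx
  obtain ⟨A, hA, hAσ⟩ := hg (g x)
  -- The displacements of `A`.
  have hdisp : ∀ z, A *ᵥ z - z = g.symm (sympForm (g z) (g x) • g x) := by
    intro z
    rw [← hAσ, sympTransvection_apply, map_add, one_mul, g.symm_apply_apply,
      add_sub_cancel_left]
  have hsub : ((F ∙ x : Submodule F (l ⊕ l → F)) : Set (l ⊕ l → F)) ⊆
      g.symm '' ((F ∙ g x : Submodule F (l ⊕ l → F)) : Set (l ⊕ l → F)) := by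
    intro z hz
    obtain ⟨c, rfl⟩ := Submodule.mem_span_singleton.1 hz
    obtain ⟨w, hw⟩ : ∃ w, sympForm (g w) (g x) = 1 := by
      obtain ⟨w, hw⟩ := exists_sympForm_ne_zero hgx
      refine ⟨g.symm ((-(sympForm (g x) w)⁻¹) • w), ?_⟩
      rw [g.apply_symm_apply, sympForm_smul_left, sympForm_swap w, neg_mul_neg,
        inv_mul_cancel₀ hw]
    have hcx : A *ᵥ (c • w) - c • w = c • x := by
      rw [mulVec_smul, ← smul_sub, hdisp, hw, one_smul, g.symm_apply_apply]
    rw [← hcx, hdisp]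
    exact Set.mem_image_of_mem _ (Submodule.smul_mem _ _ (Submodule.mem_span_singleton_self _))
  have heq := Set.eq_of_subset_of_ncard_le hsub (by
    rw [Set.ncard_image_of_injective _ g.symm.injective, ← Nat.card_coe_set_eq,
      ← Nat.card_coe_set_eq]
    exact (Nat.card_congr ((LinearEquiv.toSpanNonzeroSingleton F _ x hx).symm.trans
      (LinearEquiv.toSpanNonzeroSingleton F _ (g x) hgx)).toEquiv).ge)
  have hdisp' : ∀ z, ∃ c : F, A *ᵥ z = z + c • x := by
    intro z
    have : A *ᵥ z - z ∈ ((F ∙ x : Submodule F (l ⊕ l → F)) : Set (l ⊕ l → F)) := by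
      rw [heq, hdisp]
      exact Set.mem_image_of_mem _
        (Submodule.smul_mem _ _ (Submodule.mem_span_singleton_self _))
    obtain ⟨c, hc⟩ := Submodule.mem_span_singleton.1 this
    exact ⟨c, by rw [hc, add_sub_cancel]⟩
  have hfix : A *ᵥ y = y := by
    obtain ⟨c, hc⟩ := hdisp' y
    obtain ⟨w, hw⟩ := exists_sympForm_ne_zero hx
    obtain ⟨d, hd⟩ := hdisp' w
    have := mem_symplecticGroup_iff_sympForm.1 hA y w
    rw [hc, hd] at this
    simp only [sympForm_add_left, sympForm_add_right, sympForm_smul_left, sympForm_smul_right,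
      sympForm_self, sympForm_swap y x, hxy] at this
    have hc0 : c = 0 := by
      have : c * sympForm x w = 0 := by linear_combination this
      exact (mul_eq_zero.1 this).resolve_right hw
    rw [hc, hc0, zero_smul, add_zero]
  have h0 := hdisp y
  rw [hfix, sub_self, eq_comm, map_eq_zero_iff _ g.symm.injective, smul_eq_zero] at h0
  rw [sympForm_swap, h0.resolve_right hgx, neg_zero]

end Symplectic

/-! ### Blocks meeting a Lagrangian subspace -/

section Blocks

variable {n : ℕ} {F : Type*} [Field F]

/-- The vectors of a coordinate Lagrangian subspace (the first half of the coordinates). -/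
def lagrangianEmb (n : ℕ) (F : Type*) [Field F] : (Fin n → F) ↪ (Fin n ⊕ Fin n → F) where
  toFun w := Sum.elim w 0
  inj' _ _ h := funext fun i => congrFun h (.inl i)

theorem lagrangianEmb_apply (w : Fin n → F) : lagrangianEmb n F w = Sum.elim w 0 := rfl

theorem lagrangianEmb_add (w w' : Fin n → F) :
    lagrangianEmb n F (w + w') = lagrangianEmb n F w + lagrangianEmb n F w' := by
  ext (i | i) <;> simp [lagrangianEmb_apply]

theorem sympForm_lagrangianEmb (x : Fin n ⊕ Fin n → F) (w : Fin n → F) :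
    sympForm x (lagrangianEmb n F w) = ∑ i, x (.inr i) * w i := by
  simp [sympForm_apply, lagrangianEmb_apply]

theorem sympForm_lagrangianEmb_lagrangianEmb (w w' : Fin n → F) :
    sympForm (lagrangianEmb n F w) (lagrangianEmb n F w') = 0 := by
  rw [sympForm_lagrangianEmb]
  simp [lagrangianEmb_apply]

theorem mem_range_lagrangianEmb {x : Fin n ⊕ Fin n → F} :
    x ∈ Set.range (lagrangianEmb n F) ↔ ∀ i, x (.inr i) = 0 := by
  constructor
  · rintro ⟨w, rfl⟩ i
    rfl
  · intro h
    refine ⟨fun i => x (.inl i), ?_⟩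
    ext (i | i)
    · rfl
    · exact (h i).symm

variable {𝓑 : Set (Finset (Fin n ⊕ Fin n → F))} {t v k : ℕ}

/-- A block with `t` points in a Lagrangian subspace `W` is invariant under all transvections
with centre in `W`; these generate a group that is transitive on every coset `x + W ≠ W`. -/
theorem add_lagrangianEmb_mem_block (hD : IsDesign 𝓑 t v k 1)
    (hτ : ∀ (u : Fin n ⊕ Fin n → F) (c : F), sympTransvection u c ∈ designAut 𝓑)
    {S : Finset (Fin n → F)} {B : Finset (Fin n ⊕ Fin n → F)} (hB : B ∈ 𝓑)
    (hS : t ≤ S.card) (hSB : S.map (lagrangianEmb n F) ⊆ B) {x : Fin n ⊕ Fin n → F}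
    (hx : x ∈ B) (hxW : x ∉ Set.range (lagrangianEmb n F)) (w : Fin n → F) :
    x + lagrangianEmb n F w ∈ B := by
  classical
  have hinv : ∀ (u : Fin n → F) (c : F), ∀ y ∈ B,
      sympTransvection (lagrangianEmb n F u) c y ∈ B := by
    intro u c y hy
    refine hD.apply_mem_block (hτ _ c) (S := S.map (lagrangianEmb n F)) (by simpa using hS)
      hB hSB ?_ hy
    intro z hz
    obtain ⟨w', -, rfl⟩ := Finset.mem_map.1 hz
    exact sympTransvection_apply_of_orthogonal c (sympForm_lagrangianEmb_lagrangianEmb _ _)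
  have hone : ∀ (u : Fin n → F), ∀ y ∈ B, sympForm y (lagrangianEmb n F u) ≠ 0 →
      y + lagrangianEmb n F u ∈ B := by
    intro u y hy hne
    have := hinv u (sympForm y (lagrangianEmb n F u))⁻¹ y hy
    rwa [sympTransvection_apply, inv_mul_cancel₀ hne, one_smul] at this
  by_cases h : sympForm x (lagrangianEmb n F w) = 0
  · -- Write `w` as a sum of two vectors that are not orthogonal to `x`.
    obtain ⟨i, hi⟩ : ∃ i, x (.inr i) ≠ 0 := by
      by_contra! h0
      exact hxW (mem_range_lagrangianEmb.2 h0)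
    have h1 : sympForm x (lagrangianEmb n F (Pi.single i 1)) ≠ 0 := by
      rw [sympForm_lagrangianEmb]
      simpa [Pi.single_apply] using hi
    have hsum : lagrangianEmb n F w = lagrangianEmb n F (Pi.single i 1) +
        lagrangianEmb n F (w - Pi.single i 1) := by
      rw [← lagrangianEmb_add, add_sub_cancel]
    rw [hsum, ← add_assoc]
    refine hone _ _ (hone _ x hx h1) ?_
    rw [sympForm_add_left, sympForm_lagrangianEmb_lagrangianEmb, add_zero]
    intro h2
    rw [hsum, sympForm_add_right, h2, add_zero] at h
    exact h1 h
  · exact hone w x hx h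

/-- A block with `t` points in a Lagrangian subspace `W` lies in `W`: otherwise it has
`t + |W|` points at least, which is too many since `|W| ^ 2` is the number of all points. -/
theorem block_subset_lagrangian [Finite F] (hN : IsNontrivialSteinerDesign 𝓑 t v k)
    (ht : 2 ≤ t)
    (hτ : ∀ (u : Fin n ⊕ Fin n → F) (c : F), sympTransvection u c ∈ designAut 𝓑)
    {S : Finset (Fin n → F)} {B : Finset (Fin n ⊕ Fin n → F)} (hB : B ∈ 𝓑)
    (hS : S.card = t) (hSB : S.map (lagrangianEmb n F) ⊆ B) {x : Fin n ⊕ Fin n → F}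
    (hx : x ∈ B) : x ∈ Set.range (lagrangianEmb n F) := by
  classical
  have := Fintype.ofFinite F
  by_contra hxW
  obtain ⟨q, hq⟩ : ∃ q, Fintype.card (Fin n → F) = q := ⟨_, rfl⟩
  have hv : v = q * q := by
    rw [← hN.1.card_points, Nat.card_eq_fintype_card, ← hq,
      Fintype.card_congr (Equiv.sumArrowEquivProdArrow (Fin n) (Fin n) F), Fintype.card_prod]
  have hsub : S.map (lagrangianEmb n F) ∪
      Finset.univ.map ((lagrangianEmb n F).trans (addLeftEmbedding x)) ⊆ B := by
    refine Finset.union_subset hSB fun y hy => ?_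
    obtain ⟨w, -, rfl⟩ := Finset.mem_map.1 hy
    exact add_lagrangianEmb_mem_block hN.1 hτ hB hS.ge hSB hx hxW w
  have hle := Finset.card_le_card hsub
  rw [Finset.card_union_of_disjoint, Finset.card_map, Finset.card_map, Finset.card_univ, hq,
    hS, hN.1.card_block B hB] at hle
  · have hbound := hN.card_bound ht
    rw [hv] at hbound
    obtain ⟨m, rfl⟩ : ∃ m, k = t + m := ⟨k - t, by omega⟩
    have e1 : t + m + 2 - t = m + 2 := by omega
    have e2 : t + m + 1 - t = m + 1 := by omega
    rw [e1, e2] at hbound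
    have : q ≤ m := by omega
    nlinarith [Nat.mul_le_mul this this]
  · rw [Finset.disjoint_left]
    intro y hy hy'
    obtain ⟨w, -, rfl⟩ := Finset.mem_map.1 hy
    obtain ⟨w', -, hw'⟩ := Finset.mem_map.1 hy'
    refine hxW (mem_range_lagrangianEmb.2 fun i => ?_)
    have := congrFun hw' (.inr i)
    simpa [lagrangianEmb_apply] using this

/-- If every block is the image of every other one under a permutation `x ↦ g x + c` with `g`
additive and preserving orthogonality, then a Lagrangian subspace has fewer than `t` points:
otherwise some block is contained in it, so that in each block containing `0` any two points
are orthogonal. -/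
theorem card_lagrangian_lt [Finite F] (hn : 0 < n) (hN : IsNontrivialSteinerDesign 𝓑 t v k)
    (ht : 3 ≤ t)
    (hτ : ∀ (u : Fin n ⊕ Fin n → F) (c : F), sympTransvection u c ∈ designAut 𝓑)
    (htrans : ∀ B ∈ 𝓑, ∀ C ∈ 𝓑, ∃ (g : (Fin n ⊕ Fin n → F) ≃+ (Fin n ⊕ Fin n → F))
      (c : Fin n ⊕ Fin n → F), (∀ x y, sympForm x y = 0 → sympForm (g x) (g y) = 0) ∧
        ∀ z ∈ C, ∃ x ∈ B, g x + c = z) :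
    Nat.card (Fin n → F) < t := by
  classical
  have := Fintype.ofFinite F
  by_contra! hle
  rw [Nat.card_eq_fintype_card, ← Finset.card_univ] at hle
  obtain ⟨S, -, hS⟩ := Finset.exists_subset_card_eq hle
  obtain ⟨B, hB, hSB⟩ :=
    hN.1.exists_block (S := S.map (lagrangianEmb n F)) (by rw [Finset.card_map, hS])
  have hBW : ∀ x ∈ B, x ∈ Set.range (lagrangianEmb n F) := fun x hx =>
    block_subset_lagrangian hN (by omega) hτ hB hS hSB hx
  set x : Fin n ⊕ Fin n → F := Pi.single (.inr ⟨0, hn⟩) 1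
  set y : Fin n ⊕ Fin n → F := Pi.single (.inl ⟨0, hn⟩) 1
  have hxy : sympForm x y ≠ 0 := by
    simp [x, y, sympForm_single_inl]
  obtain ⟨R, hR, -, hRt⟩ := Finset.exists_subsuperset_card_eq (n := t)
    (Finset.subset_univ ({0, x, y} : Finset (Fin n ⊕ Fin n → F)))
    (Finset.card_le_three.trans ht) (by
      rw [Finset.card_univ, ← Nat.card_eq_fintype_card, hN.1.card_points]
      exact hN.1.t_le_k.trans hN.1.k_le_v)
  obtain ⟨C, hC, hRC⟩ := hN.1.exists_block hRt
  obtain ⟨g, c, hg, hgC⟩ := htrans B hB C hC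
  obtain ⟨b, hbB, hb⟩ := hgC 0 (hRC (hR (by simp)))
  obtain ⟨x', hxB, hx'⟩ := hgC x (hRC (hR (by simp)))
  obtain ⟨y', hyB, hy'⟩ := hgC y (hRC (hR (by simp)))
  obtain ⟨wb, rfl⟩ := hBW b hbB
  obtain ⟨wx, rfl⟩ := hBW x' hxB
  obtain ⟨wy, rfl⟩ := hBW y' hyB
  have hdiff : ∀ w z, g (lagrangianEmb n F w) + c = z → z = g (lagrangianEmb n F (w - wb)) := by
    intro w z hz
    have : lagrangianEmb n F w = lagrangianEmb n F (w - wb) + lagrangianEmb n F wb := by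
      rw [← lagrangianEmb_add, sub_add_cancel]
    rw [← hz, this, map_add, add_assoc, hb, add_zero]
  apply hxy
  rw [hdiff _ _ hx', hdiff _ _ hy']
  exact hg _ _ (sympForm_lagrangianEmb_lagrangianEmb _ _)

/-- The case of `16` points: a Lagrangian plane has only `4` points. Take the block through it
and one further point. It lies in a hyperplane, since otherwise invariance under two
transvections forces `8` points into it. But a block through the zero vector and a basis is not
contained in the image of a hyperplane. -/
theorem not_steiner_five_sixteen {F : Type*} [Field F] (hF : Nat.card F = 2)
    {𝓑 : Set (Finset (Fin 2 ⊕ Fin 2 → F))} {v k : ℕ}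
    (hN : IsNontrivialSteinerDesign 𝓑 5 v k)
    (hτ : ∀ (u : Fin 2 ⊕ Fin 2 → F) (c : F), sympTransvection u c ∈ designAut 𝓑)
    (htrans : ∀ B ∈ 𝓑, ∀ C ∈ 𝓑, ∃ (g : (Fin 2 ⊕ Fin 2 → F) ≃+ (Fin 2 ⊕ Fin 2 → F))
      (c : Fin 2 ⊕ Fin 2 → F), ∀ z ∈ C, ∃ x ∈ B, g x + c = z) : False := by
  classical
  have := Nat.finite_of_card_ne_zero (show Nat.card F ≠ 0 by omega)
  have := Fintype.ofFinite F
  have h01 : ∀ c : F, c = 0 ∨ c = 1 := by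
    intro c
    have hu : ({0, 1} : Finset F) = Finset.univ := by
      rw [← Finset.card_eq_iff_eq_univ, Finset.card_pair zero_ne_one,
        ← Nat.card_eq_fintype_card, hF]
    have : c ∈ ({0, 1} : Finset F) := hu ▸ Finset.mem_univ c
    simpa using this
  have h2 : (1 : F) + 1 = 0 := (h01 _).resolve_right (by simp)
  have hk : k ≤ 7 := by
    have hv : v = 16 := by
      rw [← hN.1.card_points, Nat.card_fun, hF]
      simp
    have hb := hN.card_bound (by norm_num)
    subst hv
    by_contra! hk
    obtain ⟨m, rfl⟩ : ∃ m, k = 8 + m := ⟨k - 8, by omega⟩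
    have e1 : 8 + m + 2 - 5 = m + 5 := by omega
    have e2 : 8 + m + 1 - 5 = m + 4 := by omega
    rw [e1, e2] at hb
    nlinarith
  set P : Finset (Fin 2 ⊕ Fin 2 → F) := Finset.univ.map (lagrangianEmb 2 F)
  have hP : P.card = 4 := by
    rw [Finset.card_map, Finset.card_univ, ← Nat.card_eq_fintype_card, Nat.card_fun, hF]
    simp
  have hPmem : ∀ z, z ∈ P ↔ ∀ i, z (.inr i) = 0 := by
    intro z
    rw [← mem_range_lagrangianEmb]
    simp [P]
  have hins : ∀ z, z ∉ P → (insert z P).card = 5 := fun z hz => by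
    rw [Finset.card_insert_of_notMem hz, hP]
  set x : Fin 2 ⊕ Fin 2 → F := Pi.single (.inr 1) 1
  have hxP : x ∉ P := fun h => by simpa [x] using (hPmem x).1 h 1
  obtain ⟨B, hB, hxB⟩ := hN.1.exists_block (hins x hxP)
  have hPB := (Finset.subset_insert x P).trans hxB
  replace hxB : x ∈ B := hxB (Finset.mem_insert_self _ _)
  -- For `y` outside the Lagrangian plane, `B` is invariant under the transvection whose centre
  -- lies in the plane and is orthogonal to `y`.
  have hinv : ∀ y ∈ B, y ∉ P → ∀ w : Fin 2 → F,
      sympForm y (lagrangianEmb 2 F w) = 0 → ∀ z ∈ B,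
      sympForm z (lagrangianEmb 2 F w) = 1 → z + lagrangianEmb 2 F w ∈ B := by
    intro y hy hyP w hw z hz hzw
    have := hN.1.apply_mem_block (hτ (lagrangianEmb 2 F w) 1) (hins y hyP).ge hB
      (Finset.insert_subset hy hPB) ?_ hz
    · rwa [sympTransvection_apply, hzw, one_mul, one_smul] at this
    · intro s hs
      apply sympTransvection_apply_of_orthogonal
      rcases Finset.mem_insert.1 hs with rfl | hs
      · exact hw
      · obtain ⟨w', -, rfl⟩ := Finset.mem_map.1 hs
        exact sympForm_lagrangianEmb_lagrangianEmb _ _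
  -- The hyperplane orthogonal to the first basis vector contains `B`.
  have hH : ∀ y ∈ B, y (.inr 0) = 0 := by
    intro y hy
    refine (h01 _).resolve_right fun hy0 => ?_
    have hyP : y ∉ P := fun h => by simp [(hPmem y).1 h 0] at hy0
    have hy' : y + lagrangianEmb 2 F ![1, 0] ∈ B := by
      refine hinv x hxB hxP _ ?_ y hy ?_
      · simp [sympForm_lagrangianEmb, x]
      · simp [sympForm_lagrangianEmb, hy0]
    have hx' : x + lagrangianEmb 2 F ![y (.inr 1), 1] ∈ B := by
      refine hinv y hy hyP _ ?_ x hxB ?_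
      · rw [sympForm_lagrangianEmb]
        rcases h01 (y (.inr 1)) with h | h <;> simp [hy0, h, h2]
      · simp [sympForm_lagrangianEmb, x]
    have hsub : insert (y + lagrangianEmb 2 F ![1, 0]) (insert y
        (insert (x + lagrangianEmb 2 F ![y (.inr 1), 1]) (insert x P))) ⊆ B := by
      simp only [Finset.insert_subset_iff]
      exact ⟨hy', hy, hx', hxB, hPB⟩
    have hle := Finset.card_le_card hsub
    rw [hN.1.card_block B hB, Finset.card_insert_of_notMem, Finset.card_insert_of_notMem,
      Finset.card_insert_of_notMem, hins x hxP] at hle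
    · omega
    · simp only [Finset.mem_insert, not_or]
      refine ⟨fun h => ?_, fun h => ?_⟩
      · simpa [lagrangianEmb_apply] using congrFun h (.inl 1)
      · simpa [x, lagrangianEmb_apply] using (hPmem _).1 h 1
    · simp only [Finset.mem_insert, not_or]
      refine ⟨fun h => ?_, fun h => ?_, hyP⟩
      · simpa [x, hy0, lagrangianEmb_apply] using congrFun h (.inr 0)
      · simpa [x, hy0] using congrFun h (.inr 0)
    · simp only [Finset.mem_insert, not_or]
      refine ⟨fun h => ?_, fun h => ?_, fun h => ?_, fun h => ?_⟩
      · simpa [lagrangianEmb_apply] using congrFun h (.inl 0)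
      · simpa [x, hy0, lagrangianEmb_apply] using congrFun h (.inr 0)
      · simpa [x, hy0, lagrangianEmb_apply] using congrFun h (.inr 0)
      · simpa [hy0, lagrangianEmb_apply] using (hPmem _).1 h 0
  have hbasis : (insert 0 (Finset.univ.image fun i => (Pi.single i 1 : Fin 2 ⊕ Fin 2 → F))).card
      = 5 := by
    rw [Finset.card_insert_of_notMem, Finset.card_image_of_injective, Finset.card_univ]
    · simp
    · intro i j hij
      by_contra hne
      simpa [Pi.single_apply, hne] using congrFun hij i
    · simp
  obtain ⟨C, hC, hbC⟩ := hN.1.exists_block hbasis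
  obtain ⟨g, c, hgC⟩ := htrans B hB C hC
  obtain ⟨b, hbB, hb⟩ := hgC 0 (hbC (by simp))
  -- The image of the hyperplane under `g` contains a basis, so it is everything.
  have hg1 : ∀ i, g.symm (Pi.single i 1) (.inr 0) = 0 := by
    intro i
    obtain ⟨z, hzB, hz⟩ := hgC (Pi.single i 1) (hbC (by simp))
    have : g.symm (Pi.single i 1) = z - b := by
      rw [AddEquiv.symm_apply_eq, map_sub, ← hz, ← add_sub_add_right_eq_sub _ _ c, hb, sub_zero]
    rw [this, Pi.sub_apply, hH z hzB, hH b hbB, sub_zero]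
  have hall : ∀ z, g.symm z (.inr 0) = 0 := by
    intro z
    rw [← Finset.univ_sum_single z, map_sum, Finset.sum_apply]
    refine Finset.sum_eq_zero fun i _ => ?_
    rcases h01 (z i) with h | h <;> rw [h]
    · simp
    · exact hg1 i
  simpa using hall (g (Pi.single (.inr 0) 1))

end Blocks

/-! ### Groups of affine type containing the symplectic group -/

section Affine

open Matrix

variable {X : Type*} {p d a : ℕ} [Fact p.Prime] {G : Subgroup (Equiv.Perm X)}

/-- A symplectic permutation group of affine type acts by maps `x ↦ g x + c` with `g` additive,
because `T` is normal, and preserving orthogonality, because the symplectic group is normal in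
the stabilizer of zero. -/
theorem IsAffineTypeSp.exists_coordinates (h : IsAffineTypeSp p d a G) :
    ∃ e : X ≃ SpSpace p a (d / a),
      (∀ u c, e.permCongr.symm (sympTransvection u c) ∈ G) ∧
      ∀ g ∈ G, ∃ (f : SpSpace p a (d / a) ≃+ SpSpace p a (d / a)) (c : SpSpace p a (d / a)),
        (∀ x, e (g x) = f (e x) + c) ∧
        ∀ x y, sympForm x y = 0 → sympForm (f x) (f y) = 0 := by
  obtain ⟨T, e, hT, hTe, hSp, hnorm⟩ := h
  have hτSp : ∀ u c, e.permCongr.symm (sympTransvection u c) ∈ spPerm e := by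
    intro u c
    obtain ⟨A, hA, h⟩ := exists_matrix_sympTransvection u c
    exact ⟨A, hA, fun x => by simp [← h]⟩
  refine ⟨e, fun u c => (hSp (hτSp u c)).1, fun g hg => ?_⟩
  -- The permutation `g₀`, the composite of `g` with a translation, fixes the zero vector.
  set c := e (g (e.symm 0)) with hc
  obtain ⟨s, hs⟩ : ∃ s : Equiv.Perm X, ∀ x, e (s x) = e x + -c :=
    ⟨e.permCongr.symm (Equiv.addRight (-c)), fun x => by simp⟩
  have hsT : s ∈ T := (hTe s).2 ⟨-c, hs⟩
  set g₀ : Equiv.Perm X := s * g with hg₀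
  have hg₀G : g₀ ∈ G := mul_mem (hT.le hsT) hg
  have hg₀e : ∀ x, e (g₀ x) = e (g x) - c := fun x => by
    rw [hg₀, Equiv.Perm.mul_apply, hs, sub_eq_add_neg]
  have hg₀0 : g₀ (e.symm 0) = e.symm 0 := by
    rw [← e.apply_eq_iff_eq, hg₀e, hc, sub_self, e.apply_symm_apply]
  have hg₀S : g₀ ∈ pointStabilizer G (e.symm 0) := ⟨hg₀G, hg₀0⟩
  have hadd : ∀ x y, e (g₀ (e.symm (x + y))) = e (g₀ (e.symm x)) + e (g₀ (e.symm y)) := by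
    intro x y
    obtain ⟨r, hr⟩ : ∃ r : Equiv.Perm X, ∀ z, e (r z) = e z + y :=
      ⟨e.permCongr.symm (Equiv.addRight y), fun x => by simp⟩
    have hrT : r ∈ T := (hTe r).2 ⟨y, hr⟩
    have hconj : g₀ * r * g₀⁻¹ ∈ T :=
      hT.normal.conj_mem ⟨r, hT.le hrT⟩ hrT ⟨g₀, hg₀G⟩
    obtain ⟨u, hu⟩ := (hTe _).1 hconj
    have hu' : ∀ z, e (g₀ (e.symm (z + y))) = e (g₀ (e.symm z)) + u := by
      intro z
      have h1 := hu (g₀ (e.symm z))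
      rw [Equiv.Perm.mul_apply, Equiv.Perm.mul_apply,
        show g₀⁻¹ (g₀ (e.symm z)) = e.symm z from g₀.symm_apply_apply _] at h1
      rw [← h1]
      congr 2
      rw [Equiv.symm_apply_eq, hr, e.apply_symm_apply]
    have h0 := hu' 0
    rw [zero_add, hg₀0, e.apply_symm_apply, zero_add] at h0
    rw [hu', h0]
  let f : SpSpace p a (d / a) ≃+ SpSpace p a (d / a) :=
    { e.permCongr g₀ with map_add' := hadd }
  have hf : ∀ x, f x = e (g₀ (e.symm x)) := fun _ => rfl
  have hfs : ∀ x, f.symm x = e (g₀⁻¹ (e.symm x)) := fun _ => rfl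
  refine ⟨f, c, fun x => ?_, fun x y => sympForm_map_eq_zero f fun u => ?_⟩
  · rw [hf, e.symm_apply_apply, hg₀e, sub_add_cancel]
  · have hconj : g₀⁻¹ * e.permCongr.symm (sympTransvection u 1) * g₀ ∈ spPerm e := by
      have := Subgroup.mem_subgroupOf.1
        (hnorm.conj_mem ⟨_, hSp (hτSp u 1)⟩ (hτSp u 1) (⟨g₀, hg₀S⟩⁻¹))
      rwa [inv_inv] at this
    obtain ⟨A, hA, h⟩ := hconj
    refine ⟨A, hA, fun x => ?_⟩
    have := h (e.symm x)
    rw [e.apply_symm_apply] at this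
    rw [← this, hfs, hf]
    simp

end Affine

theorem mainTheorem4 {X : Type*} (p d a : ℕ) [Fact p.Prime] (ha : 0 < a) (had : a ∣ d)
    (hd : 2 * a ≤ d) (t : ℕ) (ht : t = 4 ∨ t = 5) :
    ¬ ∃ (v k : ℕ) (𝓑 : Set (Finset X)) (G : Subgroup (Equiv.Perm X)),
      IsNontrivialSteinerDesign 𝓑 t v k ∧
      G ≤ designAut 𝓑 ∧
      IsBlockTransitive G 𝓑 ∧
      IsAffineTypeSp p d a G := by
  -- Carry the design over to the coordinate space.
  rintro ⟨v, k, 𝓑, G, hN, hG, htrans, hSp⟩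
  obtain ⟨e, hτ, hGe⟩ := hSp.exists_coordinates
  have hn : 2 ≤ d / a := (Nat.le_div_iff_mul_le ha).2 hd
  generalize d / a = n at e hn
  have hN' := hN.transport e
  set 𝓒 : Set (Finset (SpSpace p a n)) := {B | B.map e.symm.toEmbedding ∈ 𝓑}
  have hτ' : ∀ u c, sympTransvection u c ∈ designAut 𝓒 := by
    intro u c B
    have h := hG (hτ u c) (B.map e.symm.toEmbedding)
    rw [Finset.map_map] at h
    change (B.map _).map _ ∈ 𝓑 ↔ _
    rw [Finset.map_map]
    have e' : (Equiv.toEmbedding (sympTransvection u c)).trans e.symm.toEmbedding =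
        e.symm.toEmbedding.trans (e.permCongr.symm (sympTransvection u c)).toEmbedding := by
      ext x
      simp
    rw [e']
    exact h
  have htrans' : ∀ B ∈ 𝓒, ∀ C ∈ 𝓒, ∃ (f : SpSpace p a n ≃+ SpSpace p a n) (c : SpSpace p a n),
      (∀ x y, sympForm x y = 0 → sympForm (f x) (f y) = 0) ∧
        ∀ z ∈ C, ∃ x ∈ B, f x + c = z := by
    intro B hB C hC
    obtain ⟨g, hg, hBC⟩ := htrans _ hB _ hC
    obtain ⟨f, c, hf, horth⟩ := hGe g hg
    refine ⟨f, c, horth, fun z hz => ?_⟩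
    have hz' : e.symm z ∈ C.map e.symm.toEmbedding := Finset.mem_map_of_mem _ hz
    rw [← hBC] at hz'
    obtain ⟨y, hy, hyz⟩ := Finset.mem_map.1 hz'
    obtain ⟨x, hx, rfl⟩ := Finset.mem_map.1 hy
    refine ⟨x, hx, ?_⟩
    have h := hf (e.symm x)
    rw [e.apply_symm_apply] at h
    rw [← h]
    exact (e.symm_apply_eq.1 hyz.symm).symm
  have hlt := card_lagrangian_lt (by omega) hN' (by omega) hτ' htrans'
  rw [Nat.card_fun, Nat.card_fin] at hlt
  have hq : 1 < Nat.card (GaloisField p a) := Finite.one_lt_card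
  -- Since `q ^ n < t ≤ 5` and `n ≥ 2`, only `q = 2`, `n = 2`, `t = 5` is left.
  have hq2 : Nat.card (GaloisField p a) = 2 := by
    by_contra hne
    have h1 : 3 ^ 2 ≤ Nat.card (GaloisField p a) ^ n :=
      (Nat.pow_le_pow_left (by omega) 2).trans (Nat.pow_le_pow_right (by omega) hn)
    omega
  have hn2 : n = 2 := by
    by_contra hne
    rw [hq2] at hlt
    have h1 : 2 ^ 3 ≤ 2 ^ n := Nat.pow_le_pow_right (by omega) (by omega)
    omega
  subst hn2
  have ht5 : t = 5 := by
    rw [hq2] at hlt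
    omega
  subst ht5
  refine not_steiner_five_sixteen hq2 hN' hτ' fun B hB C hC => ?_
  obtain ⟨f, c, -, h⟩ := htrans' B hB C hC
  exact ⟨f, c, h⟩
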